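/- Let $P=\sum_{i=1}^k \omega_i P_i$ be a mixture of probability distributions $P_1,\dots,P_k$ on $\mathbb{R}^d$, with weights $\omega_1\ge\omega_2\ge\cdots\ge\omega_k\ge 0$, $\sum_{i=1}^k\omega_i=1$. Suppose that every $P_i$ has a finite second moment, mean vector $\boldsymbol{\mu}_i$, and total variance $\mathbb{E}_{\mathbf{X}\sim P_i}\bigl[\Vert\mathbf{X}-\boldsymbol{\mu}_i\Vert_2^2\bigr]\le\sigma_i^2$. Let $\sigma>0$, let $k_{\sigma}(\mathbf{x},\mathbf{y})=\exp\bigl(-\Vert\mathbf{x}-\mathbf{y}\Vert_2^2/(2\sigma^2)\bigr)$ be the Gaussian kernel with bandwidth $\sigma$, let $\phi:\mathbb{R}^d\to H$ be any feature map of it into a real Hilbert space $H$, i.e. $\langle\phi(\mathbf{x}),\phi(\mathbf{y})\rangle=k_{\sigma}(\mathbf{x},\mathbf{y})$ for all $\mathbf{x},\mathbf{y}$, and let $C_{\mathbf{X}}=\mathbb{E}_{\mathbf{X}\sim P}\bigl[\phi(\mathbf{X})\phi(\mathbf{X})^\top\bigr]$ be the kernel covariance operator on $H$. Let $\lambda_1\ge\cdots\ge\lambda_k\ge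 0$ be the top $k$ eigenvalues of $C_{\mathbf{X}}$, counted with multiplicity (with $\lambda_i=0$ if $C_{\mathbf{X}}$ has fewer than $i$ positive eigenvalues). Then $$\sum_{i=1}^k(\lambda_i-\omega_i)^2\;\le\;4\sum_{i=1}^k\omega_i\frac{\sigma_i^2}{\sigma^2}+16\sum_{i=2}^k\sum_{j=1}^{i-1}\omega_i\exp\Bigl(\frac{-\Vert\boldsymbol{\mu}_i-\boldsymbol{\mu}_j\Vert_2^2}{\sigma^2}\Bigr).$$ -/

import Mathlib

open MeasureTheory ProbabilityTheory
open scoped RealInnerProductSpace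

noncomputable section

/-- The normalized Gaussian kernel with bandwidth `σ`,
`k(x, y) = exp (-‖x - y‖² / (2 σ²))` for the Euclidean norm. -/
def gaussianKernel {d : ℕ} (σ : ℝ) (x y : EuclideanSpace ℝ (Fin d)) : ℝ :=
  Real.exp (-‖x - y‖ ^ 2 / (2 * σ ^ 2))

/-- `φ` is a feature map of the kernel `K`: `⟨φ x, φ y⟩ = K x y` for all `x`, `y`. -/
def IsFeatureMap {X : Type*} {H : Type*} [NormedAddCommGroup H] [InnerProductSpace ℝ H]
    (K : X → X → ℝ) (φ : X → H) : Prop :=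
  ∀ x y, ⟪φ x, φ y⟫ = K x y

/-- The kernel covariance operator `C = E_{X ∼ P} [φ(X) φ(X)ᵀ]` of a distribution `P` (not centered),
a Bochner integral of the rank one operators `φ(x) φ(x)ᵀ : h ↦ ⟨φ x, h⟩ φ x`. -/
def kernelCovariance {X : Type*} [MeasurableSpace X]
    {H : Type*} [NormedAddCommGroup H] [InnerProductSpace ℝ H]
    (φ : X → H) (P : Measure X) : H →L[ℝ] H :=
  ∫ x, InnerProductSpace.rankOne ℝ (φ x) (φ x) ∂P

/-- The number of eigenvalues `≥ c` of `T`, counted with multiplicity.  Eigenspaces of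
different eigenvalues are independent, so that the rank of their sum is the sum of the
multiplicities. -/
def eigenvalueCount {H : Type*} [NormedAddCommGroup H] [InnerProductSpace ℝ H]
    (T : H →L[ℝ] H) (c : ℝ) : Cardinal :=
  Module.rank ℝ ↥(⨆ ν ∈ Set.Ici c, Module.End.eigenspace (T : H →ₗ[ℝ] H) ν)

/-- For a compact positive operator `T`, the `n`-th largest eigenvalue, counted with multiplicity
and with `n` starting at `0`; it is `0` if `T` has at most `n` positive eigenvalues (the
supremum is then over the empty set). -/
def topEigenvalue {H : Type*} [NormedAddCommGroup H] [InnerProductSpace ℝ H]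
    (T : H →L[ℝ] H) (n : ℕ) : ℝ :=
  sSup {c : ℝ | 0 < c ∧ ((n + 1 : ℕ) : Cardinal) ≤ eigenvalueCount T c}

/-- The mixture distribution `∑ ω_i P_i`. -/
def mixture {X : Type*} [MeasurableSpace X] {k : ℕ} (ω : Fin k → ℝ) (P : Fin k → Measure X) :
    Measure X :=
  ∑ i, ENNReal.ofReal (ω i) • P i

/-- The Gaussian kernel has a feature map into a real Hilbert space, for instance the
random Fourier features `x ↦ (t ↦ exp (i ⟨t, x⟩ / σ))` in `L²` of the standard Gaussian. -/
theorem exists_isFeatureMap_gaussianKernel (d : ℕ) (σ : ℝ) :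
    ∃ (H : Type) (_ : NormedAddCommGroup H) (_ : InnerProductSpace ℝ H) (_ : CompleteSpace H)
      (φ : EuclideanSpace ℝ (Fin d) → H), IsFeatureMap (gaussianKernel σ) φ := by
  let γ := stdGaussian (EuclideanSpace ℝ (Fin d))
  let f : EuclideanSpace ℝ (Fin d) → EuclideanSpace ℝ (Fin d) → ℂ :=
    fun x t => Complex.exp ((⟪t, σ⁻¹ • x⟫ : ℝ) * Complex.I)
  have hf : ∀ x, MemLp (f x) 2 γ := by
    intro x
    refine MemLp.of_bound (C := 1) ?_ ?_
    · exact Continuous.aestronglyMeasurable (by fun_prop)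
    · exact Filter.Eventually.of_forall fun t => by
        simp only [f, Complex.norm_exp_ofReal_mul_I, le_refl]
  refine ⟨Lp ℂ 2 γ, inferInstance, InnerProductSpace.rclikeToReal ℂ _, inferInstance,
    fun x => (hf x).toLp, fun x y => ?_⟩
  change RCLike.re (inner ℂ (hf x).toLp (hf y).toLp) = _
  have h1 : inner ℂ (hf x).toLp (hf y).toLp = charFun γ (σ⁻¹ • (y - x)) := by
    rw [L2.inner_def, charFun_apply]
    refine integral_congr_ae ?_
    filter_upwards [(hf x).coeFn_toLp, (hf y).coeFn_toLp] with t h1 h2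
    rw [h1, h2]
    simp only [f, RCLike.inner_apply, ← Complex.exp_conj, ← Complex.exp_add, smul_sub,
      inner_sub_right]
    congr 1
    simp
    ring
  rw [h1, charFun_stdGaussian, gaussianKernel]
  have h2 : (-(‖σ⁻¹ • (y - x)‖ : ℂ) ^ 2 / 2) = ((-‖x - y‖ ^ 2 / (2 * σ ^ 2) : ℝ) : ℂ) := by
    rw [norm_smul, norm_sub_rev y x, Real.norm_eq_abs]
    have : (|σ⁻¹| * ‖x - y‖) ^ 2 = ‖x - y‖ ^ 2 / σ ^ 2 := by
      rw [mul_pow, sq_abs, inv_pow]; ring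
    have h3 := congrArg (fun r : ℝ => ((-r / 2 : ℝ) : ℂ)) this
    push_cast at h3 ⊢
    rw [h3]
    ring
  rw [h2, ← Complex.ofReal_exp]
  exact Complex.ofReal_re _

end

/-!
The eigenvalues `λ` of the covariance operator `C` are compared with the weights `ω` through the
eigenvalues `g` of `A = ∑ ω i φ(μ i) φ(μ i)ᵀ`, the covariance operator of the mixture with every
component concentrated at its mean. Since `(λ - ω)² ≤ 2 (λ - g)² + 2 (g - ω)²`, two applications of
the Hoffman–Wielandt inequality (the `ℓ²` distance of the sorted eigenvalues is at most the
Hilbert–Schmidt distance of the operators) suffice.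

* `C` against `A`: the Hilbert–Schmidt inner product of rank one operators is
  `⟪φ(x) φ(x)ᵀ, φ(y) φ(y)ᵀ⟫ = ⟪φ x, φ y⟫²`, the square of the kernel, which is again a Gaussian kernel
  and has a feature map `ψ`. So `‖C - A‖² = ‖∫ ψ - ∑ ω i ψ(μ i)‖²`, and by convexity this is at most
  `∑ ω i ‖∫ ψ dP i - ψ(μ i)‖² ≤ 2 ∑ ω i (s i)² / σ²` (`IsFeatureMap.norm_integral_sub_sq_le`).
* `A` against `diag ω`: `A` has the nonzero eigenvalues of the Gram matrix with entries
  `√(ω i ω j) K(μ i, μ j)`, whose diagonal is `ω`. The distance of the two is the sum of the squared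
  off-diagonal entries, at most `2 ∑_{j < i} ω i K(μ i, μ j)²`.

The Hoffman–Wielandt inequalities come from expanding the square, Ky Fan's maximum principle for the
mixed term (`IsSortedEigensystem.sum_mul_inner_le`, `exists_gram_eigenvalues`), and
`sum_sq_eigenvalue_le` for `∑ λ²`. They need the eigenvalues of the compact positive operator `C` in
decreasing order, with eigenvectors; these are constructed in `exists_isSortedEigensystem`, and
identified with `topEigenvalue` in `IsSortedEigensystem.topEigenvalue_eq`.
-/

open MeasureTheory ProbabilityTheory
open scoped RealInnerProductSpace

/-! ### Rearrangement inequality and Bessel's inequality -/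

/-- Summation by parts: `a` decreasing and nonnegative, `z` with nonnegative partial sums. -/
theorem sum_range_mul_nonneg_of_antitone {a z : ℕ → ℝ} (ha : Antitone a) (n : ℕ)
    (ha0 : ∀ i < n, 0 ≤ a i) (hz : ∀ m ≤ n, 0 ≤ ∑ i ∈ Finset.range m, z i) :
    0 ≤ ∑ i ∈ Finset.range n, a i * z i := by
  have key : ∀ m ≤ n, a m * ∑ i ∈ Finset.range m, z i ≤ ∑ i ∈ Finset.range m, a i * z i := by
    intro m
    induction m with
    | zero => simp
    | succ m ih =>
      intro hm
      rw [Finset.sum_range_succ (fun i => a i * z i)]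
      have h1 := mul_le_mul_of_nonneg_right (ha (Nat.le_succ m)) (hz (m + 1) hm)
      rw [Finset.sum_range_succ, mul_add] at h1
      have h2 := ih (by omega)
      rw [Finset.sum_range_succ, mul_add]
      linarith
  cases n with
  | zero => simp
  | succ n =>
    rw [Finset.sum_range_succ]
    have h1 := key n (by omega)
    have h2 := mul_nonneg (ha0 n (by omega)) (hz (n + 1) le_rfl)
    rw [Finset.sum_range_succ, mul_add] at h2
    linarith

/-- If `y` dominates `x` in all initial sums, it does so after weighting with a decreasing
nonnegative `a`. -/
theorem sum_mul_le_sum_mul_of_antitone {k : ℕ} {a x y : Fin k → ℝ} (ha : Antitone a)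
    (ha0 : ∀ i, 0 ≤ a i) (h : ∀ m : ℕ, ∑ i with i.val < m, x i ≤ ∑ i with i.val < m, y i) :
    ∑ i, a i * x i ≤ ∑ i, a i * y i := by
  -- extend `a` and `y - x` by zero to `ℕ`
  let a' : ℕ → ℝ := fun n => if h : n < k then a ⟨n, h⟩ else 0
  let z' : ℕ → ℝ := fun n => if h : n < k then y ⟨n, h⟩ - x ⟨n, h⟩ else 0
  have hanti : Antitone a' := by
    intro m n hmn
    simp only [a']
    split_ifs with h1 h2
    · exact ha hmn
    · omega
    · exact ha0 _
    · rfl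
  have hz : ∀ m ≤ k, 0 ≤ ∑ i ∈ Finset.range m, z' i := by
    intro m hm
    have : ∑ i ∈ Finset.range m, z' i = ∑ i : Fin k with i.val < m, (y i - x i) := by
      symm
      refine Finset.sum_bij (fun i _ => i.val) ?_ ?_ ?_ ?_
      · simp
      · intro i _ j _ hij
        exact Fin.ext hij
      · intro b hb
        have hb' := Finset.mem_range.1 hb
        exact ⟨⟨b, by omega⟩, by simpa using hb', rfl⟩
      · intro i _
        simp [z']
    rw [this, Finset.sum_sub_distrib]
    linarith [h m]
  have h0 := sum_range_mul_nonneg_of_antitone hanti k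
    (fun i hi => by simp only [a', hi, dite_true]; exact ha0 _) hz
  rw [← Fin.sum_univ_eq_sum_range (fun i => a' i * z' i)] at h0
  simp only [a', z', Fin.is_lt, dite_true, Fin.eta, mul_sub, Finset.sum_sub_distrib] at h0
  linarith

/-- The rearrangement inequality for a doubly substochastic matrix in place of a permutation. -/
theorem sum_sum_mul_le_of_substochastic {k : ℕ} {a b : Fin k → ℝ} (ha : Antitone a)
    (ha0 : ∀ i, 0 ≤ a i) (hb : Antitone b) (hb0 : ∀ i, 0 ≤ b i) {S : Fin k → Fin k → ℝ}
    (hS : ∀ i j, 0 ≤ S i j) (hrow : ∀ i, ∑ j, S i j ≤ 1) (hcol : ∀ j, ∑ i, S i j ≤ 1) :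
    ∑ j, b j * ∑ i, a i * S i j ≤ ∑ i, a i * b i := by
  have hswap : ∑ j, b j * ∑ i, a i * S i j = ∑ i, a i * ∑ j, b j * S i j := by
    simp_rw [Finset.mul_sum]
    rw [Finset.sum_comm]
    exact Finset.sum_congr rfl fun i _ => Finset.sum_congr rfl fun j _ => by ring
  rw [hswap]
  refine sum_mul_le_sum_mul_of_antitone ha ha0 fun m => ?_
  have h1 : ∑ i with i.val < m, ∑ j, b j * S i j = ∑ j, b j * ∑ i with i.val < m, S i j := by
    rw [Finset.sum_comm]
    simp_rw [Finset.mul_sum]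
  have h2 : ∑ i with i.val < m, b i = ∑ j, b j * if j.val < m then 1 else 0 := by
    simp [Finset.sum_filter]
  rw [h1, h2]
  refine sum_mul_le_sum_mul_of_antitone hb hb0 fun p => ?_
  rcases le_total p m with hpm | hmp
  · have : ∀ j ∈ Finset.univ.filter (fun j : Fin k => j.val < p),
        (if j.val < m then (1 : ℝ) else 0) = 1 := by
      intro j hj
      simp only [Finset.mem_filter, Finset.mem_univ, true_and] at hj
      rw [if_pos (by omega)]
    rw [Finset.sum_congr rfl this]
    refine Finset.sum_le_sum fun j _ => le_trans ?_ (hcol j)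
    exact Finset.sum_le_sum_of_subset_of_nonneg (Finset.subset_univ _) fun i _ _ => hS i j
  · have : ∑ j : Fin k with j.val < p, (if j.val < m then (1 : ℝ) else 0)
        = ∑ j : Fin k with j.val < m, 1 := by
      rw [Finset.sum_ite, Finset.sum_const_zero, add_zero, Finset.filter_filter]
      congr 1
      ext j
      simp only [Finset.mem_filter, Finset.mem_univ, true_and]
      omega
    rw [this, Finset.sum_comm]
    refine Finset.sum_le_sum fun i _ => le_trans ?_ (hrow i)
    exact Finset.sum_le_sum_of_subset_of_nonneg (Finset.subset_univ _) fun j _ _ => hS i j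

section
variable {H : Type*} [NormedAddCommGroup H] [InnerProductSpace ℝ H]

/-- The distance of `x` to its projection, without normalization of the orthogonal family: the
factor `2 - ‖e i‖ ^ 2` is `1` for a unit vector, and its value at a zero vector is irrelevant. -/
theorem norm_sub_sum_inner_smul_sq {ι : Type*} (s : Finset ι) {e : ι → H}
    (horth : Pairwise fun i j => ⟪e i, e j⟫ = 0) (x : H) :
    ‖x - ∑ i ∈ s, ⟪e i, x⟫ • e i‖ ^ 2
      = ‖x‖ ^ 2 - ∑ i ∈ s, ⟪e i, x⟫ ^ 2 * (2 - ‖e i‖ ^ 2) := by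
  classical
  have h1 : ⟪x, ∑ i ∈ s, ⟪e i, x⟫ • e i⟫ = ∑ i ∈ s, ⟪e i, x⟫ ^ 2 := by
    rw [inner_sum]
    refine Finset.sum_congr rfl fun i _ => ?_
    rw [real_inner_smul_right, real_inner_comm x (e i)]
    ring
  have h2 : ‖∑ i ∈ s, ⟪e i, x⟫ • e i‖ ^ 2 = ∑ i ∈ s, ⟪e i, x⟫ ^ 2 * ‖e i‖ ^ 2 := by
    rw [← real_inner_self_eq_norm_sq, sum_inner]
    refine Finset.sum_congr rfl fun i hi => ?_
    rw [inner_sum, Finset.sum_eq_single_of_mem i hi]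
    · rw [real_inner_smul_left, real_inner_smul_right, real_inner_self_eq_norm_sq]
      ring
    · intro j _ hj
      rw [real_inner_smul_left, real_inner_smul_right, horth hj.symm]
      ring
  rw [norm_sub_sq_real, h1, h2]
  simp_rw [mul_sub, Finset.sum_sub_distrib]
  rw [← Finset.sum_mul]
  ring

/-- Bessel's inequality for an orthogonal family of vectors of norm at most `1`; zero vectors
are allowed, so that the family may be longer than the dimension of the space. -/
theorem sum_inner_sq_le_norm_sq {ι : Type*} (s : Finset ι) {e : ι → H}
    (horth : Pairwise fun i j => ⟪e i, e j⟫ = 0) (hnorm : ∀ i, ‖e i‖ ≤ 1) (x : H) :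
    ∑ i ∈ s, ⟪e i, x⟫ ^ 2 ≤ ‖x‖ ^ 2 := by
  have h1 := norm_sub_sum_inner_smul_sq s horth x
  have h2 := sq_nonneg ‖x - ∑ i ∈ s, ⟪e i, x⟫ • e i‖
  have h3 : ∑ i ∈ s, ⟪e i, x⟫ ^ 2 ≤ ∑ i ∈ s, ⟪e i, x⟫ ^ 2 * (2 - ‖e i‖ ^ 2) := by
    refine Finset.sum_le_sum fun i _ => ?_
    have : ‖e i‖ ^ 2 ≤ 1 := pow_le_one₀ (norm_nonneg _) (hnorm i)
    nlinarith [sq_nonneg ⟪e i, x⟫]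
  linarith
end

/-! ### Eigenvalues of compact positive operators -/

section
variable {H : Type*} [NormedAddCommGroup H] [InnerProductSpace ℝ H]

/-- The norm of a compact positive operator is an eigenvalue, by the Fredholm alternative. The
chosen eigenvector is a unit vector, and `0` for the zero operator, which may live on the zero
space. -/
theorem exists_norm_eigenvector [CompleteSpace H] {S : H →L[ℝ] H} (hc : IsCompactOperator S)
    (hp : S.IsPositive) : ∃ e : H, S e = ‖S‖ • e ∧ (S = 0 → e = 0) ∧ (S ≠ 0 → ‖e‖ = 1) := by
  by_cases h0 : S = 0
  · exact ⟨0, by simp, fun _ => rfl, fun h => absurd h0 h⟩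
  have hnt : Nontrivial H := by
    by_contra h
    rw [not_nontrivial_iff_subsingleton] at h
    exact h0 (Subsingleton.elim _ _)
  have hev : Module.End.HasEigenvalue (S : Module.End ℝ H) ‖S‖ := by
    refine (hc.hasEigenvalue_or_mem_resolventSet (norm_ne_zero_iff.2 h0)).resolve_right
      fun hres => ?_
    obtain ⟨ε, hε, hle⟩ := S.rayleighQuotient_le_of_norm_mem_resolventSet (by simpa using hres)
    have hnorm := S.norm_eq_iSup_rayleighQuotient hp.isSymmetric
    have hsup : ⨆ x, |S.rayleighQuotient x| ≤ ‖S‖ - ε := by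
      refine ciSup_le fun x => ?_
      have h0 : 0 ≤ S.rayleighQuotient x :=
        div_nonneg (hp.inner_nonneg_left x) (sq_nonneg _)
      rw [abs_of_nonneg h0]
      exact hle x
    linarith
  obtain ⟨v, hv⟩ := hev.exists_hasEigenvector
  have hv0 : ‖v‖ ≠ 0 := norm_ne_zero_iff.2 hv.2
  have hSv : S v = ‖S‖ • v := hv.apply_eq_smul
  refine ⟨‖v‖⁻¹ • v, ?_, fun h => absurd h h0, fun _ => ?_⟩
  · rw [map_smul, hSv, smul_comm]
  · rw [norm_smul, norm_inv, norm_norm, inv_mul_cancel₀ hv0]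

theorem isCompactOperator_rankOne (x y : H) :
    IsCompactOperator (InnerProductSpace.rankOne ℝ x y) := by
  rw [InnerProductSpace.rankOne_def']
  exact (isCompactOperator_of_locallyCompactSpace_rng
    (ContinuousLinearMap.toSpanSingleton ℝ x)).comp_clm _

/-- Subtracting from a positive operator its component along an eigenvector leaves a positive
operator. -/
theorem isPositive_sub_smul_rankOne {S : H →L[ℝ] H} (hp : S.IsPositive) {c : ℝ} {e : H}
    (he : S e = c • e) (hn : e = 0 ∨ ‖e‖ = 1) :
    (S - c • InnerProductSpace.rankOne ℝ e e).IsPositive := by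
  rw [ContinuousLinearMap.isPositive_iff]
  refine ⟨?_, fun x => ?_⟩
  · intro x y
    have := hp.isSymmetric x y
    simp only [ContinuousLinearMap.coe_coe, _root_.sub_apply,
      _root_.smul_apply, InnerProductSpace.rankOne_apply, inner_sub_left,
      inner_sub_right, real_inner_smul_left, real_inner_smul_right] at this ⊢
    rw [this, real_inner_comm x e]
    ring
  · rcases hn with rfl | hn
    · simpa using hp.inner_nonneg_left x
    -- the form of the difference at `x` is that of `S` at the component of `x` orthogonal to `e`
    · have h := hp.inner_nonneg_left (x - ⟪e, x⟫ • e)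
      have h1 : ⟪S x, e⟫ = c * ⟪e, x⟫ := by
        have h : ⟪S x, e⟫ = ⟪x, S e⟫ := hp.isSymmetric x e
        rw [h, he, real_inner_smul_right, real_inner_comm]
      have h2 : ⟪e, e⟫ = 1 := by rw [real_inner_self_eq_norm_sq, hn, one_pow]
      simp only [map_sub, map_smul, he, inner_sub_left, inner_sub_right, real_inner_smul_left,
        real_inner_smul_right, _root_.sub_apply, _root_.smul_apply,
        InnerProductSpace.rankOne_apply, h1, h2] at h ⊢
      linarith

/-- `l` lists the largest eigenvalues of the positive operator `T` in decreasing order, and `e`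
orthonormal eigenvectors of them. When the positive eigenvalues are exhausted, `l n = 0`, and
`e n` is either a unit vector or zero; this allows sequences indexed by `ℕ` in every dimension.
That no eigenvalue is skipped is expressed by `inner_le`: `T` is at most `l n` on the orthogonal
complement of the first `n` eigenvectors. -/
structure IsSortedEigensystem (T : H →L[ℝ] H) (l : ℕ → ℝ) (e : ℕ → H) : Prop where
  antitone : Antitone l
  nonneg : ∀ n, 0 ≤ l n
  apply_eq : ∀ n, T (e n) = l n • e n
  eq_zero_or_norm : ∀ n, e n = 0 ∨ ‖e n‖ = 1
  norm_eq_one : ∀ n, 0 < l n → ‖e n‖ = 1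
  orthogonal : Pairwise fun i j => ⟪e i, e j⟫ = 0
  le_inner : ∀ n x, ∑ i ∈ Finset.range n, l i * ⟪e i, x⟫ ^ 2 ≤ ⟪T x, x⟫
  inner_le : ∀ n x, ⟪T x, x⟫ ≤ ∑ i ∈ Finset.range n, l i * ⟪e i, x⟫ ^ 2
    + l n * (‖x‖ ^ 2 - ∑ i ∈ Finset.range n, ⟪e i, x⟫ ^ 2)

/-- Existence by deflation: an eigenvector of the largest eigenvalue of a compact positive operator
is split off repeatedly. -/
theorem exists_isSortedEigensystem [CompleteSpace H] {T : H →L[ℝ] H} (hc : IsCompactOperator T)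
    (hp : T.IsPositive) : ∃ l e, IsSortedEigensystem T l e := by
  choose ev hev hev0 hev1 using
    fun S : {S : H →L[ℝ] H // IsCompactOperator S ∧ S.IsPositive} =>
      exists_norm_eigenvector S.2.1 S.2.2
  have hevn : ∀ S, ev S = 0 ∨ ‖ev S‖ = 1 := fun S => by
    by_cases h : S.1 = 0
    · exact Or.inl (hev0 S h)
    · exact Or.inr (hev1 S h)
  let step : {S : H →L[ℝ] H // IsCompactOperator S ∧ S.IsPositive} →
      {S : H →L[ℝ] H // IsCompactOperator S ∧ S.IsPositive} := fun S =>
    ⟨S.1 - ‖S.1‖ • InnerProductSpace.rankOne ℝ (ev S) (ev S),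
      S.2.1.sub ((isCompactOperator_rankOne _ _).smul _),
      isPositive_sub_smul_rankOne S.2.2 (hev S) (hevn S)⟩
  -- `R n` is what remains of `T` after `n` steps
  let R : ℕ → {S : H →L[ℝ] H // IsCompactOperator S ∧ S.IsPositive} := fun n =>
    step^[n] ⟨T, hc, hp⟩
  let l : ℕ → ℝ := fun n => ‖(R n).1‖
  let e : ℕ → H := fun n => ev (R n)
  have hRsucc : ∀ n x, (R (n + 1)).1 x = (R n).1 x - (l n * ⟪e n, x⟫) • e n := by
    intro n x
    simp only [R, Function.iterate_succ_apply', step, l, e, mul_smul]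
    rfl
  have hRe : ∀ n, (R n).1 (e n) = l n • e n := fun n => hev (R n)
  have hsymm : ∀ n x y, ⟪(R n).1 x, y⟫ = ⟪x, (R n).1 y⟫ := fun n => (R n).2.2.isSymmetric
  have hnorm : ∀ n, e n = 0 ∨ ‖e n‖ = 1 := fun n => hevn _
  have hl : ∀ n, 0 ≤ l n := fun n => norm_nonneg _
  have hl1 : ∀ n, 0 < l n → ‖e n‖ = 1 := fun n h => hev1 _ (norm_pos_iff.1 h)
  have hker : ∀ n v, (R n).1 v = 0 → ⟪e n, v⟫ = 0 := by
    intro n v hv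
    by_cases h : (R n).1 = 0
    · simp [e, hev0 _ h]
    · have h1 : l n * ⟪e n, v⟫ = 0 := by
        rw [← real_inner_smul_left, ← hRe, hsymm, hv, inner_zero_right]
      exact (mul_eq_zero.1 h1).resolve_left (norm_ne_zero_iff.2 h)
  -- what has been split off stays in the kernel, whence the orthogonality
  have hkill : ∀ i n, i < n → (R n).1 (e i) = 0 := by
    intro i n hin
    induction n, hin using Nat.le_induction with
    | base =>
      rw [hRsucc, hRe, ← sub_smul]
      rcases hnorm i with h | h
      · rw [h, smul_zero]
      · rw [real_inner_self_eq_norm_sq, h]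
        simp
    | succ n _ ih => rw [hRsucc, ih, hker n _ ih]; simp
  have horth : Pairwise fun i j => ⟪e i, e j⟫ = 0 := by
    intro i j hij
    rcases hij.lt_or_gt with h | h
    · rw [real_inner_comm]
      exact hker j _ (hkill i j h)
    · exact hker i _ (hkill j i h)
  have hT : ∀ n x, T x = (R n).1 x + ∑ i ∈ Finset.range n, (l i * ⟪e i, x⟫) • e i := by
    intro n x
    induction n with
    | zero => simp [R]
    | succ n ih => rw [ih, hRsucc, Finset.sum_range_succ]; abel
  have hform : ∀ n x, ⟪T x, x⟫ = ⟪(R n).1 x, x⟫ + ∑ i ∈ Finset.range n, l i * ⟪e i, x⟫ ^ 2 := by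
    intro n x
    rw [hT n x, inner_add_left, sum_inner]
    congr 1
    refine Finset.sum_congr rfl fun i _ => ?_
    rw [real_inner_smul_left]
    ring
  refine ⟨l, e, ⟨antitone_nat_of_succ_le fun n => ?_, hl, fun n => ?_, hnorm, hl1, horth,
    fun n x => ?_, fun n x => ?_⟩⟩
  · rcases (hl (n + 1)).eq_or_lt with h | h
    · rw [← h]; exact hl n
    · have h1 := hl1 _ h
      have h2 : (R (n + 1)).1 (e (n + 1)) = (R n).1 (e (n + 1)) := by
        rw [hRsucc, horth (Nat.succ_ne_self n).symm]; simp
      have h3 := (R n).1.le_opNorm (e (n + 1))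
      rw [← h2, hRe, norm_smul, h1, Real.norm_of_nonneg (hl _)] at h3
      simpa using h3
  · rw [hT n, hRe, Finset.sum_eq_zero, add_zero]
    intro i hi
    rw [horth (Finset.mem_range.1 hi).ne]
    simp
  · rw [hform n x]
    linarith [(R n).2.2.inner_nonneg_left x]
  · rw [hform n x, add_comm]
    gcongr
    -- the form of `R n` at `x` only sees the component `y` orthogonal to `e 0, …, e (n - 1)`
    set y := x - ∑ i ∈ Finset.range n, ⟪e i, x⟫ • e i with hy
    have hRy : (R n).1 y = (R n).1 x := by
      rw [hy, map_sub, map_sum, Finset.sum_eq_zero, sub_zero]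
      intro i hi
      rw [map_smul, hkill i n (Finset.mem_range.1 hi), smul_zero]
    have h1 : ⟪(R n).1 x, x⟫ = ⟪(R n).1 y, y⟫ := by
      rw [hsymm n y y, hRy, ← hsymm, hRy]
    have h2 : ⟪(R n).1 y, y⟫ ≤ l n * ‖y‖ ^ 2 := by
      refine (real_inner_le_norm _ _).trans ?_
      have := (R n).1.le_opNorm y
      nlinarith [norm_nonneg y]
    have h3 : ‖y‖ ^ 2 = ‖x‖ ^ 2 - ∑ i ∈ Finset.range n, ⟪e i, x⟫ ^ 2 := by
      rw [hy, norm_sub_sum_inner_smul_sq _ horth]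
      congr 1
      refine Finset.sum_congr rfl fun i _ => ?_
      rcases hnorm i with h | h
      · simp [h]
      · rw [h]; ring
    rw [h1, ← h3]
    exact h2

namespace IsSortedEigensystem

variable {T : H →L[ℝ] H} {l : ℕ → ℝ} {e : ℕ → H}

theorem norm_le_one (h : IsSortedEigensystem T l e) (n : ℕ) : ‖e n‖ ≤ 1 := by
  rcases h.eq_zero_or_norm n with h | h
  · simp [h]
  · exact h.le

theorem le_eigenvalueCount (h : IsSortedEigensystem T l e) {n : ℕ} (hn : 0 < l n) :
    ((n + 1 : ℕ) : Cardinal) ≤ eigenvalueCount T (l n) := by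
  set V : Submodule ℝ H := ⨆ ν ∈ Set.Ici (l n), Module.End.eigenspace (T : H →ₗ[ℝ] H) ν with hV
  have hmem : ∀ i : Fin (n + 1), e i ∈ V := fun i => by
    refine Submodule.mem_iSup_of_mem (l i) (Submodule.mem_iSup_of_mem
      (h.antitone (Nat.lt_succ_iff.1 i.2)) ?_)
    exact Module.End.mem_eigenspace_iff.2 (h.apply_eq i)
  have hon : Orthonormal ℝ fun i : Fin (n + 1) => e i :=
    ⟨fun i => h.norm_eq_one _ (hn.trans_le (h.antitone (Nat.lt_succ_iff.1 i.2))),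
      fun i j hij => h.orthogonal (Fin.val_ne_of_ne hij)⟩
  have hli : LinearIndependent ℝ fun i : Fin (n + 1) => (⟨e i, hmem i⟩ : V) :=
    LinearIndependent.of_comp V.subtype hon.linearIndependent
  simpa using! hli.cardinal_lift_le_rank

/-- Eigenvectors of different eigenvalues being orthogonal, the quadratic form is bounded
below on the span of the eigenspaces. -/
theorem _root_.LinearMap.IsSymmetric.mul_norm_sq_le_inner_of_mem_iSup {T : H →ₗ[ℝ] H}
    (hT : T.IsSymmetric) {c : ℝ} {x : H}
    (hx : x ∈ ⨆ ν ∈ Set.Ici c, Module.End.eigenspace T ν) : c * ‖x‖ ^ 2 ≤ ⟪T x, x⟫ := by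
  classical
  rw [iSup_subtype', Submodule.mem_iSup_iff_exists_dfinsupp'] at hx
  obtain ⟨f, rfl⟩ := hx
  have hf : ∀ i, T (f i) = i.1 • (f i : H) := fun i => Module.End.mem_eigenspace_iff.1 (f i).2
  have horth : ∀ i j, i ≠ j → ⟪(f i : H), (f j : H)⟫ = 0 := fun i j hij =>
    hT.orthogonalFamily_eigenspaces (fun h => hij (Subtype.ext h)) (f i) (f j)
  rw [DFinsupp.sum, ← real_inner_self_eq_norm_sq, map_sum, sum_inner, sum_inner, Finset.mul_sum]
  refine Finset.sum_le_sum fun i hi => ?_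
  rw [inner_sum, inner_sum, Finset.sum_eq_single_of_mem i hi, Finset.sum_eq_single_of_mem i hi,
    hf, real_inner_smul_left]
  · exact mul_le_mul_of_nonneg_right i.2 real_inner_self_nonneg
  · intro j _ hj
    rw [hf, real_inner_smul_left, horth i j hj.symm, mul_zero]
  · intro j _ hj
    exact horth i j hj.symm

/-- The minimax argument: a space of dimension `n + 1` on which the form of `T` is at least `c`
meets the orthogonal complement of the first `n` eigenvectors, where the form is at most `l n`. -/
theorem le_of_le_eigenvalueCount (h : IsSortedEigensystem T l e)
    (hT : (T : H →ₗ[ℝ] H).IsSymmetric) {n : ℕ} {c : ℝ}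
    (hn : ((n + 1 : ℕ) : Cardinal) ≤ eigenvalueCount T c) : c ≤ l n := by
  set V : Submodule ℝ H := ⨆ ν ∈ Set.Ici c, Module.End.eigenspace (T : H →ₗ[ℝ] H) ν with hV
  -- a nonzero vector of `V` orthogonal to the first `n` eigenvectors
  obtain ⟨x, hx0, hx⟩ : ∃ x : V, x ≠ 0 ∧ ∀ i : Fin n, ⟪e i, (x : H)⟫ = 0 := by
    let L : V →ₗ[ℝ] (Fin n → ℝ) :=
      LinearMap.pi fun i => (innerₗ H (e i)).comp V.subtype
    have hnotinj : ¬ Function.Injective L := by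
      intro hinj
      have h1 := LinearMap.lift_rank_le_of_injective L hinj
      rw [rank_fin_fun, Cardinal.lift_natCast] at h1
      have h2 := (Cardinal.lift_le.{0}.2 hn).trans h1
      rw [Cardinal.lift_natCast, Nat.cast_le] at h2
      omega
    rw [← LinearMap.ker_eq_bot, Submodule.eq_bot_iff] at hnotinj
    push Not at hnotinj
    obtain ⟨x, hx, hx0⟩ := hnotinj
    exact ⟨x, hx0, fun i => congrFun (LinearMap.mem_ker.1 hx) i⟩
  have h1 := hT.mul_norm_sq_le_inner_of_mem_iSup x.2
  have h2 := h.inner_le n x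
  have h3 : ∀ i ∈ Finset.range n, ⟪e i, (x : H)⟫ = 0 := fun i hi =>
    hx ⟨i, Finset.mem_range.1 hi⟩
  rw [Finset.sum_eq_zero fun i hi => by rw [h3 i hi]; ring,
    Finset.sum_eq_zero fun i hi => by rw [h3 i hi]; ring, zero_add, sub_zero] at h2
  have hpos : 0 < ‖(x : H)‖ ^ 2 := by
    have : ‖(x : H)‖ ≠ 0 := by simpa using hx0
    positivity
  exact le_of_mul_le_mul_right (h1.trans h2) hpos

theorem topEigenvalue_eq (h : IsSortedEigensystem T l e)
    (hT : (T : H →ₗ[ℝ] H).IsSymmetric) (n : ℕ) : topEigenvalue T n = l n := by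
  have hle : ∀ c ∈ {c : ℝ | 0 < c ∧ ((n + 1 : ℕ) : Cardinal) ≤ eigenvalueCount T c}, c ≤ l n :=
    fun c hc => h.le_of_le_eigenvalueCount hT hc.2
  refine le_antisymm (Real.sSup_le hle (h.nonneg n)) ?_
  rcases (h.nonneg n).eq_or_lt with h0 | h0
  · rw [← h0]
    exact Real.sSup_nonneg fun c hc => hc.1.le
  · exact le_csSup ⟨l n, hle⟩ ⟨h0, h.le_eigenvalueCount h0⟩

end IsSortedEigensystem
end

/-! ### Ky Fan's inequality and Gram operators -/

section
variable {H : Type*} [NormedAddCommGroup H] [InnerProductSpace ℝ H]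

/-- A weighted form of Ky Fan's maximum principle: on orthogonal vectors of norm at most `1`, the
weighted trace of `T` is largest at the eigenvectors. -/
theorem IsSortedEigensystem.sum_mul_inner_le {T : H →L[ℝ] H} {l : ℕ → ℝ} {e : ℕ → H}
    (h : IsSortedEigensystem T l e) {k : ℕ} {b : Fin k → ℝ} (hb : Antitone b)
    (hb0 : ∀ i, 0 ≤ b i) {u : Fin k → H} (hu : Pairwise fun i j => ⟪u i, u j⟫ = 0)
    (hu1 : ∀ i, ‖u i‖ ≤ 1) : ∑ j, b j * ⟪T (u j), u j⟫ ≤ ∑ j : Fin k, l j * b j := by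
  -- `l k` is split off, as the part of `T` beyond the first `k` eigenvectors is at most `l k`
  have hb1 : ∀ j, ⟪T (u j), u j⟫
      ≤ ∑ i : Fin k, (l i - l k) * ⟪e i, u j⟫ ^ 2 + l k := fun j => by
    refine (h.inner_le k (u j)).trans ?_
    rw [← Fin.sum_univ_eq_sum_range (fun i => l i * ⟪e i, u j⟫ ^ 2),
      ← Fin.sum_univ_eq_sum_range (fun i => ⟪e i, u j⟫ ^ 2)]
    simp_rw [sub_mul, Finset.sum_sub_distrib, ← Finset.mul_sum]
    have h1 : ‖u j‖ ^ 2 ≤ 1 := pow_le_one₀ (norm_nonneg _) (hu1 j)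
    nlinarith [h.nonneg k]
  have hS : ∑ j, b j * ∑ i : Fin k, (l i - l k) * ⟪e i, u j⟫ ^ 2
      ≤ ∑ i : Fin k, (l i - l k) * b i := by
    refine sum_sum_mul_le_of_substochastic (a := fun i : Fin k => l i - l k)
      (S := fun i j => ⟪e i, u j⟫ ^ 2) ?_ ?_ hb hb0 (fun _ _ => sq_nonneg _) ?_ ?_
    · exact fun i j hij => sub_le_sub_right (h.antitone hij) _
    · exact fun i => sub_nonneg.2 (h.antitone i.2.le)
    · intro i
      have h1 := sum_inner_sq_le_norm_sq Finset.univ hu hu1 (e i)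
      simp_rw [real_inner_comm (e i)] at h1
      exact h1.trans (pow_le_one₀ (norm_nonneg _) (h.norm_le_one i))
    · intro j
      have h1 := sum_inner_sq_le_norm_sq (Finset.range k) h.orthogonal h.norm_le_one (u j)
      rw [← Fin.sum_univ_eq_sum_range (fun i => ⟪e i, u j⟫ ^ 2)] at h1
      exact h1.trans (pow_le_one₀ (norm_nonneg _) (hu1 j))
  calc ∑ j, b j * ⟪T (u j), u j⟫
      ≤ ∑ j, b j * (∑ i : Fin k, (l i - l k) * ⟪e i, u j⟫ ^ 2 + l k) :=
        Finset.sum_le_sum fun j _ => mul_le_mul_of_nonneg_left (hb1 j) (hb0 j)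
    _ = ∑ j, b j * ∑ i : Fin k, (l i - l k) * ⟪e i, u j⟫ ^ 2 + ∑ j, b j * l k := by
        simp_rw [mul_add, Finset.sum_add_distrib]
    _ ≤ ∑ i : Fin k, (l i - l k) * b i + ∑ j, b j * l k := by gcongr
    _ = ∑ j : Fin k, l j * b j := by
        rw [← Finset.sum_add_distrib]
        exact Finset.sum_congr rfl fun j _ => by ring

variable {E : Type*} [NormedAddCommGroup E] [InnerProductSpace ℝ E]

/-- The trace does not depend on the orthonormal basis. -/
theorem OrthonormalBasis.sum_inner_apply_eq {ι κ : Type*} [Fintype ι] [Fintype κ]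
    (v : OrthonormalBasis ι ℝ E) (b : OrthonormalBasis κ ℝ E) (T : E →ₗ[ℝ] E) :
    ∑ i, ⟪T (v i), v i⟫ = ∑ j, ⟪T (b j), b j⟫ := by
  simp_rw [real_inner_comm _ (T _)]
  rw [← LinearMap.trace_eq_sum_inner, ← LinearMap.trace_eq_sum_inner]

/-- Let `g` be the sorted eigenvalues of the Gram operator `W† W` of the vectors `a j = W (b j)`. The
three conclusions concern `∑ g i ^ 2`, the squared Hilbert–Schmidt norm of the Gram operator; the
Gram operator against a diagonal operator with entries `w`; and `W W† = ∑ a j (a j)ᵀ`, which has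
the same nonzero eigenvalues, against an operator `T` on `H`. With the expansion of
`∑ (g i - w i) ^ 2` and `∑ (l i - g i) ^ 2` they give the Hoffman–Wielandt inequality for both
pairs. -/
theorem exists_gram_eigenvalues [CompleteSpace H] [FiniteDimensional ℝ E] [CompleteSpace E]
    {k : ℕ} (W : E →L[ℝ] H) (b : OrthonormalBasis (Fin k) ℝ E) :
    ∃ g : Fin k → ℝ,
      (∑ i, g i ^ 2 = ∑ i, ∑ j, ⟪W (b i), W (b j)⟫ ^ 2) ∧
      (∀ w : Fin k → ℝ, Antitone w → (∀ i, 0 ≤ w i) →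
        ∑ j, w j * ‖W (b j)‖ ^ 2 ≤ ∑ i, g i * w i) ∧
      (∀ (T : H →L[ℝ] H) (l : ℕ → ℝ) (e : ℕ → H), IsSortedEigensystem T l e →
        ∑ j, ⟪T (W (b j)), W (b j)⟫ ≤ ∑ i : Fin k, l i * g i) := by
  let G : E →ₗ[ℝ] E := (W.adjoint ∘L W : E →L[ℝ] E)
  have hG : ∀ x y, ⟪G x, y⟫ = ⟪W x, W y⟫ := fun x y => by
    simp [G, ContinuousLinearMap.adjoint_inner_left]
  have hsymm : G.IsSymmetric := fun x y => by
    rw [hG, real_inner_comm (G y), hG, real_inner_comm]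
  have hdim : Module.finrank ℝ E = k := by
    rw [Module.finrank_eq_card_basis b.toBasis, Fintype.card_fin]
  let g := hsymm.eigenvalues hdim
  let v := hsymm.eigenvectorBasis hdim
  have hv : ∀ i, G (v i) = g i • v i := fun i => hsymm.apply_eigenvectorBasis hdim i
  have hanti : Antitone g := hsymm.eigenvalues_antitone hdim
  have hvv : ∀ i j, ⟪v i, v j⟫ = if i = j then 1 else 0 :=
    orthonormal_iff_ite.1 v.orthonormal
  have hW : ∀ i j, ⟪W (v i), W (v j)⟫ = if i = j then g i else 0 := fun i j => by
    rw [← hG, hv, real_inner_smul_left, hvv]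
    split_ifs <;> simp
  have hg0 : ∀ i, 0 ≤ g i := fun i => by
    have h1 := hW i i
    rw [if_pos rfl] at h1
    rw [← h1]
    exact real_inner_self_nonneg
  refine ⟨g, ?_, fun w hw hw0 => ?_, fun T l e h => ?_⟩
  · have h1 : ∀ x, ⟪(G ∘ₗ G) x, x⟫ = ‖G x‖ ^ 2 := fun x => by
      rw [LinearMap.comp_apply, hsymm, real_inner_self_eq_norm_sq]
    have h2 := v.sum_inner_apply_eq b (G ∘ₗ G)
    simp_rw [h1] at h2
    calc ∑ i, g i ^ 2 = ∑ i, ‖G (v i)‖ ^ 2 := by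
          refine Finset.sum_congr rfl fun i _ => ?_
          rw [hv, norm_smul, v.norm_eq_one, mul_one, Real.norm_eq_abs, sq_abs]
      _ = ∑ i, ‖G (b i)‖ ^ 2 := h2
      _ = _ := by
          refine Finset.sum_congr rfl fun i _ => ?_
          rw [← b.sum_sq_inner_right]
          refine Finset.sum_congr rfl fun j _ => ?_
          rw [real_inner_comm, hG]
  · have h1 : ∀ j, ‖W (b j)‖ ^ 2 = ∑ i, g i * ⟪v i, b j⟫ ^ 2 := fun j => by
      rw [← real_inner_self_eq_norm_sq, ← hG, ← v.sum_inner_mul_inner (G (b j)) (b j)]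
      refine Finset.sum_congr rfl fun i _ => ?_
      rw [hsymm, hv, real_inner_smul_right, real_inner_comm]
      ring
    simp_rw [h1]
    refine sum_sum_mul_le_of_substochastic (S := fun i j => ⟪v i, b j⟫ ^ 2) hanti hg0 hw hw0
      (fun _ _ => sq_nonneg _) (fun i => ?_) (fun j => ?_)
    · rw [b.sum_sq_inner_left, v.norm_eq_one, one_pow]
    · rw [v.sum_sq_inner_right, b.norm_eq_one, one_pow]
  -- the vectors `W (v i)` are orthogonal of squared norm `g i`, and `∑ ⟪T (W (v i)), W (v i)⟫` is
  -- the trace of `W† T W`; those with `g i = 0` vanish, also after scaling by `(√0)⁻¹ = 0`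
  · have h1 : ∀ x, ⟪(W.adjoint ∘L T ∘L W : E →L[ℝ] E) x, x⟫ = ⟪T (W x), W x⟫ := fun x => by
      simp [ContinuousLinearMap.adjoint_inner_left]
    have h2 := v.sum_inner_apply_eq b (W.adjoint ∘L T ∘L W : E →L[ℝ] E)
    simp only [ContinuousLinearMap.coe_coe, h1] at h2
    rw [← h2]
    have hn : ∀ i, ‖W (v i)‖ = √(g i) := fun i => by
      rw [norm_eq_sqrt_real_inner, hW, if_pos rfl]
    have h3 := h.sum_mul_inner_le hanti hg0 (u := fun i => (√(g i))⁻¹ • W (v i)) ?_ ?_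
    · refine le_trans (le_of_eq (Finset.sum_congr rfl fun i _ => ?_)) h3
      rcases (hg0 i).eq_or_lt with h0 | h0
      · have : W (v i) = 0 := norm_eq_zero.1 (by rw [hn, ← h0, Real.sqrt_zero])
        simp [this]
      · rw [map_smul, real_inner_smul_left, real_inner_smul_right, ← mul_assoc, ← mul_assoc,
          mul_assoc (g i), ← mul_inv, Real.mul_self_sqrt h0.le, mul_inv_cancel₀ h0.ne', one_mul]
    · intro i j hij
      rw [real_inner_smul_left, real_inner_smul_right, hW, if_neg hij, mul_zero, mul_zero]
    · intro i
      rw [norm_smul, hn, Real.norm_of_nonneg (by positivity)]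
      exact inv_mul_le_one

end

/-! ### Kernel covariance operators -/

section
variable {X : Type*} [MeasurableSpace X] {H : Type*} [NormedAddCommGroup H]
  [InnerProductSpace ℝ H] {Q : Measure X} {φ : X → H}

theorem MeasureTheory.AEStronglyMeasurable.rankOne_self (hφ : AEStronglyMeasurable φ Q) :
    AEStronglyMeasurable (fun x => InnerProductSpace.rankOne ℝ (φ x) (φ x)) Q := by
  have hc : Continuous fun h : H => InnerProductSpace.rankOne ℝ h h :=
    (InnerProductSpace.rankOne ℝ).continuous.clm_apply continuous_id
  exact hc.comp_aestronglyMeasurable hφ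

theorem MeasureTheory.MemLp.integrable_rankOne_self (hφ : MemLp φ 2 Q) :
    Integrable (fun x => InnerProductSpace.rankOne ℝ (φ x) (φ x)) Q := by
  refine (hφ.integrable_norm_pow two_ne_zero).mono hφ.1.rankOne_self
    (Filter.Eventually.of_forall fun x => ?_)
  simp [pow_two]

variable [CompleteSpace H]

theorem inner_kernelCovariance_apply (hφ : MemLp φ 2 Q) (u v : H) :
    ⟪kernelCovariance φ Q u, v⟫ = ∫ x, ⟪φ x, u⟫ * ⟪φ x, v⟫ ∂Q := by
  have hi := hφ.integrable_rankOne_self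
  rw [kernelCovariance, ContinuousLinearMap.integral_apply hi, real_inner_comm, ← integral_inner]
  · refine integral_congr_ae (Filter.Eventually.of_forall fun x => ?_)
    simp only [InnerProductSpace.rankOne_apply, real_inner_smul_right, real_inner_comm v]
  · exact hi.apply_continuousLinearMap u

theorem inner_kernelCovariance_apply_self (hφ : MemLp φ 2 Q) (u : H) :
    ⟪kernelCovariance φ Q u, u⟫ = ∫ x, ⟪φ x, u⟫ ^ 2 ∂Q := by
  simp_rw [inner_kernelCovariance_apply hφ, pow_two]

theorem isPositive_kernelCovariance (hφ : MemLp φ 2 Q) : (kernelCovariance φ Q).IsPositive := by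
  rw [ContinuousLinearMap.isPositive_iff]
  refine ⟨fun u v => ?_, fun u => ?_⟩
  · simp only [ContinuousLinearMap.coe_coe]
    rw [real_inner_comm (kernelCovariance φ Q v), inner_kernelCovariance_apply hφ,
      inner_kernelCovariance_apply hφ]
    simp_rw [mul_comm]
  · rw [inner_kernelCovariance_apply_self hφ]
    exact integral_nonneg fun x => sq_nonneg _

/-- Compact operators form a closed subspace, which contains the average of rank one operators. -/
theorem isCompactOperator_kernelCovariance [IsProbabilityMeasure Q] (hφ : MemLp φ 2 Q) :
    IsCompactOperator (kernelCovariance φ Q) :=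
  (compactOperator (RingHom.id ℝ) H H).convex.integral_mem isClosed_setOfPred_isCompactOperator
    (Filter.Eventually.of_forall fun _ => isCompactOperator_rankOne _ _)
    hφ.integrable_rankOne_self

variable {F : Type*} [NormedAddCommGroup F] [InnerProductSpace ℝ F] [CompleteSpace F] {ψ : X → F}

/-- The kernel covariance operator at `φ y`, in terms of a feature map `ψ` of the squared kernel. The
squared norm of `∫ ψ` is the squared Hilbert–Schmidt norm of the operator. -/
theorem inner_kernelCovariance_feature (hφ : MemLp φ 2 Q) (hψ : Integrable ψ Q)
    (hψφ : ∀ x y, ⟪ψ x, ψ y⟫ = ⟪φ x, φ y⟫ ^ 2) (y : X) :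
    ⟪kernelCovariance φ Q (φ y), φ y⟫ = ⟪∫ x, ψ x ∂Q, ψ y⟫ := by
  rw [inner_kernelCovariance_apply_self hφ, real_inner_comm, ← integral_inner hψ]
  simp_rw [← hψφ, real_inner_comm]

/-- The squares of the eigenvalues sum to at most the squared Hilbert–Schmidt norm: integrate
`∑ l i * ⟪e i, φ y⟫ ^ 2 ≤ ⟪C (φ y), φ y⟫` over `y`. -/
theorem sum_sq_eigenvalue_le (hφ : MemLp φ 2 Q) (hψ : Integrable ψ Q)
    (hψφ : ∀ x y, ⟪ψ x, ψ y⟫ = ⟪φ x, φ y⟫ ^ 2) {l : ℕ → ℝ} {e : ℕ → H}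
    (h : IsSortedEigensystem (kernelCovariance φ Q) l e) (n : ℕ) :
    ∑ i ∈ Finset.range n, l i ^ 2 ≤ ‖∫ x, ψ x ∂Q‖ ^ 2 := by
  have hint : ∀ i ∈ Finset.range n, Integrable (fun y => l i * ⟪e i, φ y⟫ ^ 2) Q := fun i _ =>
    ((hφ.const_inner (e i)).integrable_sq).const_mul _
  have h1 : ∫ y, ∑ i ∈ Finset.range n, l i * ⟪e i, φ y⟫ ^ 2 ∂Q ≤ ∫ y, ⟪∫ x, ψ x ∂Q, ψ y⟫ ∂Q := by
    refine integral_mono (integrable_finsetSum _ hint) (hψ.const_inner _) fun y => ?_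
    have := h.le_inner n (φ y)
    rwa [inner_kernelCovariance_feature hφ hψ hψφ] at this
  rw [integral_inner hψ, real_inner_self_eq_norm_sq, integral_finsetSum _ hint] at h1
  refine le_trans (le_of_eq (Finset.sum_congr rfl fun i _ => ?_)) h1
  rw [integral_const_mul]
  simp_rw [real_inner_comm (φ _)]
  rw [← inner_kernelCovariance_apply_self hφ, h.apply_eq, real_inner_smul_left,
    real_inner_self_eq_norm_sq]
  rcases (h.nonneg i).eq_or_lt with h0 | h0
  · simp [← h0]
  · rw [h.norm_eq_one i h0]; ring

end

/-! ### Feature maps of the Gaussian kernel -/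

section
variable {d : ℕ} {σ : ℝ}

theorem gaussianKernel_self (x : EuclideanSpace ℝ (Fin d)) : gaussianKernel σ x x = 1 := by
  simp [gaussianKernel]

theorem gaussianKernel_sq (x y : EuclideanSpace ℝ (Fin d)) :
    gaussianKernel σ x y ^ 2 = Real.exp (-‖x - y‖ ^ 2 / σ ^ 2) := by
  rw [gaussianKernel, ← Real.exp_nat_mul]
  congr 1
  rcases eq_or_ne σ 0 with rfl | h
  · simp
  · push_cast; field_simp

/-- The square of a Gaussian kernel is a Gaussian kernel, so it has a feature map as well. -/
theorem gaussianKernel_div_sqrt_two (x y : EuclideanSpace ℝ (Fin d)) :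
    gaussianKernel (σ / √2) x y = gaussianKernel σ x y ^ 2 := by
  rw [gaussianKernel_sq, gaussianKernel, div_pow, Real.sq_sqrt zero_le_two,
    mul_div_cancel₀ _ two_ne_zero]

variable {H : Type*} [NormedAddCommGroup H] [InnerProductSpace ℝ H]
  {φ : EuclideanSpace ℝ (Fin d) → H}

theorem IsFeatureMap.norm_eq_one (hφ : IsFeatureMap (gaussianKernel σ) φ)
    (x : EuclideanSpace ℝ (Fin d)) : ‖φ x‖ = 1 := by
  rw [norm_eq_sqrt_real_inner, hφ, gaussianKernel_self, Real.sqrt_one]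

theorem IsFeatureMap.continuous (hφ : IsFeatureMap (gaussianKernel σ) φ) : Continuous φ := by
  rw [continuous_iff_continuousAt]
  intro y
  rw [ContinuousAt, tendsto_iff_norm_sub_tendsto_zero]
  have h1 : ∀ x, ‖φ x - φ y‖ = √(2 - 2 * gaussianKernel σ x y) := fun x => by
    rw [← Real.sqrt_sq (norm_nonneg (φ x - φ y)), norm_sub_sq_real, hφ, hφ.norm_eq_one,
      hφ.norm_eq_one]
    congr 1
    ring
  simp_rw [h1]
  have hc : Continuous fun x => √(2 - 2 * gaussianKernel σ x y) := by
    unfold gaussianKernel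
    fun_prop
  have h2 := hc.tendsto y
  simpa [gaussianKernel_self] using h2

theorem IsFeatureMap.memLp (hφ : IsFeatureMap (gaussianKernel σ) φ) (p : ENNReal)
    (Q : Measure (EuclideanSpace ℝ (Fin d))) [IsFiniteMeasure Q] : MemLp φ p Q :=
  MemLp.of_bound hφ.continuous.aestronglyMeasurable 1
    (Filter.Eventually.of_forall fun x => (hφ.norm_eq_one x).le)

/-- The mean of `φ` is close to `φ m` for a distribution concentrated near `m`. As `φ` has norm `1`,
the left side is at most `2 - 2 ∫ K(x, m)`, and `1 - exp (-t) ≤ t`. -/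
theorem IsFeatureMap.norm_integral_sub_sq_le [CompleteSpace H]
    (hφ : IsFeatureMap (gaussianKernel σ) φ)
    (Q : Measure (EuclideanSpace ℝ (Fin d))) [IsProbabilityMeasure Q]
    (hQ : MemLp (fun x => x) 2 Q) (m : EuclideanSpace ℝ (Fin d)) :
    ‖(∫ x, φ x ∂Q) - φ m‖ ^ 2 ≤ (∫ x, ‖x - m‖ ^ 2 ∂Q) / σ ^ 2 := by
  have hint : Integrable φ Q := (hφ.memLp 1 Q).integrable le_rfl
  have h1 : ‖∫ x, φ x ∂Q‖ ^ 2 ≤ 1 := by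
    refine pow_le_one₀ (norm_nonneg _) ?_
    simpa using norm_integral_le_of_norm_le_const (μ := Q)
      (Filter.Eventually.of_forall fun x => (hφ.norm_eq_one x).le)
  have h2 : 1 - (∫ x, ‖x - m‖ ^ 2 ∂Q) / (2 * σ ^ 2) ≤ ⟪∫ x, φ x ∂Q, φ m⟫ := by
    have hsq : Integrable (fun x => ‖x - m‖ ^ 2) Q :=
      (hQ.sub (memLp_const m)).integrable_norm_pow two_ne_zero
    rw [real_inner_comm, ← integral_inner hint, div_eq_mul_inv, ← integral_mul_const]
    have h3 : ∫ x, (1 - ‖x - m‖ ^ 2 * (2 * σ ^ 2)⁻¹) ∂Q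
        = 1 - ∫ x, ‖x - m‖ ^ 2 * (2 * σ ^ 2)⁻¹ ∂Q := by
      rw [integral_sub (integrable_const _) (hsq.mul_const _)]
      simp
    rw [← h3]
    refine integral_mono ((integrable_const _).sub (hsq.mul_const _)) (hint.const_inner _)
      fun x => ?_
    rw [real_inner_comm, hφ, gaussianKernel]
    have h4 := Real.add_one_le_exp (-‖x - m‖ ^ 2 / (2 * σ ^ 2))
    rw [neg_div, div_eq_mul_inv] at h4 ⊢
    linarith
  have h5 : (∫ x, ‖x - m‖ ^ 2 ∂Q) / (2 * σ ^ 2) = ((∫ x, ‖x - m‖ ^ 2 ∂Q) / σ ^ 2) / 2 := by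
    rw [mul_comm, div_mul_eq_div_div]
  rw [norm_sub_sq_real, hφ.norm_eq_one]
  rw [h5] at h2
  linarith

end

/-! ### Mixtures -/

section
variable {X : Type*} [MeasurableSpace X] {k : ℕ} {ω : Fin k → ℝ} {P : Fin k → Measure X}

theorem isProbabilityMeasure_mixture (hω : ∀ i, 0 ≤ ω i) (hω1 : ∑ i, ω i = 1)
    (hP : ∀ i, IsProbabilityMeasure (P i)) : IsProbabilityMeasure (mixture ω P) := by
  refine ⟨?_⟩
  simp only [mixture, Measure.coe_finsetSum, Finset.sum_apply, Measure.smul_apply, measure_univ,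
    smul_eq_mul, mul_one]
  rw [← ENNReal.ofReal_sum_of_nonneg fun i _ => hω i, hω1, ENNReal.ofReal_one]

theorem integral_mixture {F : Type*} [NormedAddCommGroup F] [NormedSpace ℝ F]
    (hω : ∀ i, 0 ≤ ω i) {f : X → F} (hf : ∀ i, Integrable f (P i)) :
    ∫ x, f x ∂(mixture ω P) = ∑ i, ω i • ∫ x, f x ∂(P i) := by
  rw [mixture, integral_finsetSum_measure fun i _ => (hf i).smul_measure ENNReal.ofReal_ne_top]
  refine Finset.sum_congr rfl fun i _ => ?_
  rw [integral_smul_measure, ENNReal.toReal_ofReal (hω i)]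

end

/-! ### Comparison of the spectrum with the mixture weights -/

theorem norm_sum_smul_sq_le {ι : Type*} {E : Type*} [NormedAddCommGroup E] [NormedSpace ℝ E]
    (s : Finset ι) {w : ι → ℝ} (hw : ∀ i ∈ s, 0 ≤ w i) (hw1 : ∑ i ∈ s, w i = 1) (z : ι → E) :
    ‖∑ i ∈ s, w i • z i‖ ^ 2 ≤ ∑ i ∈ s, w i * ‖z i‖ ^ 2 := by
  have hc : ConvexOn ℝ Set.univ fun x : E => ‖x‖ ^ 2 :=
    convexOn_univ_norm.pow (fun _ _ => norm_nonneg _) 2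
  exact hc.map_sum_le hw hw1 fun _ _ => Set.mem_univ _

theorem Finset.sum_sum_eq_of_symm {k : ℕ} (f : Fin k → Fin k → ℝ) (hf : ∀ i j, f i j = f j i) :
    ∑ i, ∑ j, f i j = ∑ i, f i i + 2 * ∑ i, ∑ j ∈ Finset.Iio i, f i j := by
  have h1 : ∀ i, ∑ j, f i j
      = f i i + ∑ j ∈ Finset.Iio i, f i j + ∑ j ∈ Finset.Ioi i, f i j := fun i => by
    rw [← Finset.sum_filter_add_sum_filter_not _ (fun j => j ≤ i)]
    congr 1
    · rw [← Finset.sum_insert (by simp)]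
      congr 1
      ext j
      simp [le_iff_eq_or_lt]
    · congr 1
      ext j
      simp
  have h2 : ∑ i, ∑ j ∈ Finset.Ioi i, f i j = ∑ i, ∑ j ∈ Finset.Iio i, f i j := by
    rw [Finset.sum_comm' (t' := Finset.univ) (s' := fun j => Finset.Iio j) (by simp)]
    exact Finset.sum_congr rfl fun i _ => Finset.sum_congr rfl fun j _ => hf _ _
  simp_rw [h1, Finset.sum_add_distrib]
  rw [h2]
  ring

theorem theorem1 {d k : ℕ}
    -- the mixture weights, in decreasing order
    (ω : Fin k → ℝ) (hω_nonneg : ∀ i, 0 ≤ ω i) (hω_sum : ∑ i, ω i = 1) (hω_anti : Antitone ω)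
    -- the components, with finite second moment, their means and bounds on their total variances
    (P : Fin k → Measure (EuclideanSpace ℝ (Fin d))) (hP : ∀ i, IsProbabilityMeasure (P i))
    (hP2 : ∀ i, MemLp (fun x => x) 2 (P i))
    (μ : Fin k → EuclideanSpace ℝ (Fin d)) (hμ : ∀ i, ∫ x, x ∂(P i) = μ i)
    (s : Fin k → ℝ) (hs : ∀ i, ∫ x, ‖x - μ i‖ ^ 2 ∂(P i) ≤ s i ^ 2)
    -- the bandwidth and a feature map of the Gaussian kernel
    (σ : ℝ) (hσ : 0 < σ)
    {H : Type*} [NormedAddCommGroup H] [InnerProductSpace ℝ H] [CompleteSpace H]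
    (φ : EuclideanSpace ℝ (Fin d) → H) (hφ : IsFeatureMap (gaussianKernel σ) φ) :
    ∑ i : Fin k, (topEigenvalue (kernelCovariance φ (mixture ω P)) i - ω i) ^ 2 ≤
      4 * ∑ i : Fin k, ω i * (s i ^ 2 / σ ^ 2) +
        16 * ∑ i : Fin k, ∑ j ∈ Finset.Iio i,
          ω i * Real.exp (-‖μ i - μ j‖ ^ 2 / σ ^ 2) := by
  have hQ := isProbabilityMeasure_mixture hω_nonneg hω_sum hP
  set Q := mixture ω P with hQdef
  have hφQ : MemLp φ 2 Q := hφ.memLp 2 Q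
  have hpos := isPositive_kernelCovariance hφQ
  obtain ⟨l, e, hle⟩ := exists_isSortedEigensystem (isCompactOperator_kernelCovariance hφQ) hpos
  simp_rw [hle.topEigenvalue_eq hpos.isSymmetric]
  -- a feature map of the squared kernel
  obtain ⟨F, _, _, _, ψ, hψ⟩ := exists_isFeatureMap_gaussianKernel d (σ / √2)
  have hψφ : ∀ x y, ⟪ψ x, ψ y⟫ = ⟪φ x, φ y⟫ ^ 2 := fun x y => by
    rw [hψ, hφ, gaussianKernel_div_sqrt_two]
  have hψi : ∀ (R : Measure (EuclideanSpace ℝ (Fin d))) [IsProbabilityMeasure R],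
      Integrable ψ R := fun R _ => (hψ.memLp 1 R).integrable le_rfl
  -- the Gram operator of the vectors `√(ω i) • φ (μ i)`
  let b := EuclideanSpace.basisFun (Fin k) ℝ
  let W : EuclideanSpace ℝ (Fin k) →L[ℝ] H :=
    (b.toBasis.constr ℝ fun j => √(ω j) • φ (μ j)).toContinuousLinearMap
  have hW : ∀ j, W (b j) = √(ω j) • φ (μ j) := fun j => by
    have := b.toBasis.constr_basis ℝ (fun j => √(ω j) • φ (μ j)) j
    rwa [b.coe_toBasis] at this
  obtain ⟨g, hg2, hgω, hgl⟩ := exists_gram_eigenvalues W b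
  have hWW : ∀ i j, ⟪W (b i), W (b j)⟫ ^ 2 = ω i * ω j * ⟪ψ (μ i), ψ (μ j)⟫ := fun i j => by
    rw [hW, hW, real_inner_smul_left, real_inner_smul_right, hψφ, mul_pow, mul_pow,
      Real.sq_sqrt (hω_nonneg i), Real.sq_sqrt (hω_nonneg j)]
    ring
  simp_rw [hWW] at hg2
  -- the Hilbert–Schmidt distance of the covariance operator to `∑ ω i φ(μ i) φ(μ i)ᵀ` is
  -- the distance of `∫ ψ` to `m`
  have hlg : ∑ i : Fin k, (l i - g i) ^ 2 ≤ 2 * ∑ i, ω i * (s i ^ 2 / σ ^ 2) := by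
    set m := ∑ j, ω j • ψ (μ j) with hm
    have h1 : ∑ i : Fin k, l i ^ 2 ≤ ‖∫ x, ψ x ∂Q‖ ^ 2 := by
      rw [Fin.sum_univ_eq_sum_range (fun i => l i ^ 2)]
      exact sum_sq_eigenvalue_le hφQ (hψi Q) hψφ hle k
    have h2 : ⟪∫ x, ψ x ∂Q, m⟫ ≤ ∑ i : Fin k, l i * g i := by
      refine le_trans (le_of_eq ?_) (hgl _ l e hle)
      rw [hm, inner_sum]
      refine Finset.sum_congr rfl fun j _ => ?_
      rw [hW, map_smul, real_inner_smul_left, real_inner_smul_right, real_inner_smul_right,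
        inner_kernelCovariance_feature hφQ (hψi Q) hψφ, ← mul_assoc,
        Real.mul_self_sqrt (hω_nonneg j)]
    have h3 : ∑ i, g i ^ 2 = ‖m‖ ^ 2 := by
      rw [hg2, ← real_inner_self_eq_norm_sq, hm, sum_inner]
      refine Finset.sum_congr rfl fun i _ => ?_
      rw [inner_sum]
      refine Finset.sum_congr rfl fun j _ => ?_
      rw [real_inner_smul_left, real_inner_smul_right]
      ring
    have h4 : ‖(∫ x, ψ x ∂Q) - m‖ ^ 2 ≤ 2 * ∑ i, ω i * (s i ^ 2 / σ ^ 2) := by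
      have hsub : (∫ x, ψ x ∂Q) - m = ∑ i, ω i • ((∫ x, ψ x ∂(P i)) - ψ (μ i)) := by
        rw [hQdef, integral_mixture hω_nonneg (fun i => hψi (P i)), hm, ← Finset.sum_sub_distrib]
        simp_rw [smul_sub]
      rw [hsub, Finset.mul_sum]
      refine (norm_sum_smul_sq_le _ (fun i _ => hω_nonneg i) hω_sum _).trans
        (Finset.sum_le_sum fun i _ => ?_)
      rw [mul_left_comm]
      refine mul_le_mul_of_nonneg_left ?_ (hω_nonneg i)
      refine (hψ.norm_integral_sub_sq_le (P i) (hP2 i) (μ i)).trans ?_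
      rw [div_pow, Real.sq_sqrt zero_le_two, div_div_eq_mul_div, mul_comm, ← mul_div_assoc]
      gcongr
      exact hs i
    have h5 : ∑ i : Fin k, (l i - g i) ^ 2
        = ∑ i : Fin k, l i ^ 2 - 2 * ∑ i : Fin k, l i * g i + ∑ i, g i ^ 2 := by
      rw [Finset.mul_sum, ← Finset.sum_sub_distrib, ← Finset.sum_add_distrib]
      exact Finset.sum_congr rfl fun i _ => by ring
    rw [norm_sub_sq_real] at h4
    linarith
  -- the diagonal of the Gram matrix is `ω`, so only its off-diagonal entries contribute
  have hgw : ∑ i, (g i - ω i) ^ 2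
      ≤ 2 * ∑ i, ∑ j ∈ Finset.Iio i, ω i * Real.exp (-‖μ i - μ j‖ ^ 2 / σ ^ 2) := by
    have h1 : ∑ i, (g i - ω i) ^ 2
        = ∑ i, g i ^ 2 - 2 * ∑ i, g i * ω i + ∑ i, ω i ^ 2 := by
      rw [Finset.mul_sum, ← Finset.sum_sub_distrib, ← Finset.sum_add_distrib]
      exact Finset.sum_congr rfl fun i _ => by ring
    have h2 : ∑ i, ω i ^ 2 ≤ ∑ i, g i * ω i := by
      refine le_trans (le_of_eq (Finset.sum_congr rfl fun i _ => ?_)) (hgω ω hω_anti hω_nonneg)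
      rw [hW, norm_smul, hφ.norm_eq_one, mul_one, Real.norm_eq_abs, sq_abs,
        Real.sq_sqrt (hω_nonneg i), pow_two]
    have h3 := Finset.sum_sum_eq_of_symm (fun i j => ω i * ω j * ⟪ψ (μ i), ψ (μ j)⟫)
      fun i j => by rw [real_inner_comm, mul_comm (ω i)]
    have h4 : ∑ i, ω i * ω i * ⟪ψ (μ i), ψ (μ i)⟫ = ∑ i, ω i ^ 2 := by
      refine Finset.sum_congr rfl fun i _ => ?_
      rw [real_inner_self_eq_norm_sq, hψ.norm_eq_one]
      ring
    have h5 : ∑ i, ∑ j ∈ Finset.Iio i, ω i * ω j * ⟪ψ (μ i), ψ (μ j)⟫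
        ≤ ∑ i, ∑ j ∈ Finset.Iio i, ω i * Real.exp (-‖μ i - μ j‖ ^ 2 / σ ^ 2) := by
      refine Finset.sum_le_sum fun i _ => Finset.sum_le_sum fun j _ => ?_
      have hωj : ω j ≤ 1 :=
        hω_sum ▸ Finset.single_le_sum (fun i _ => hω_nonneg i) (Finset.mem_univ j)
      rw [hψ, gaussianKernel_div_sqrt_two, gaussianKernel_sq]
      refine mul_le_mul_of_nonneg_right ?_ (Real.exp_pos _).le
      exact mul_le_of_le_one_right (hω_nonneg i) hωj
    linarith
  have hsq : ∑ i : Fin k, (l i - ω i) ^ 2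
      ≤ 2 * ∑ i : Fin k, (l i - g i) ^ 2 + 2 * ∑ i, (g i - ω i) ^ 2 := by
    rw [Finset.mul_sum, Finset.mul_sum, ← Finset.sum_add_distrib]
    refine Finset.sum_le_sum fun i _ => ?_
    nlinarith [sq_nonneg (l i - g i - (g i - ω i))]
  have hnn : 0 ≤ ∑ i, ∑ j ∈ Finset.Iio i, ω i * Real.exp (-‖μ i - μ j‖ ^ 2 / σ ^ 2) :=
    Finset.sum_nonneg fun i _ => Finset.sum_nonneg fun j _ =>
      mul_nonneg (hω_nonneg i) (Real.exp_pos _).le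
  linarith
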